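/- For $n\ge 0$ and a positive even integer $m$, consider $m$ sites $\mathcal H_1,\dots,\mathcal H_m$, each equal to $\mathbb C^{2^n}$. Let $\mathcal H^{\odot k}\subseteq\mathcal H^{\otimes k}$ be the symmetric subspace, i.e. the span of the vectors $|\phi\rangle^{\otimes k}$, let $d_{n,k}:=\dim(\mathbb C^{2^n})^{\odot k}$, and let $dU$ be the Haar probability measure on $\mathrm{SU}(2^n)$. Let $\overline U$ be the entrywise complex conjugate of $U$ in the computational basis, and let $|0\rangle$ be a fixed vector of that basis. Put $$|\Phi_m\rangle:=\sqrt{d_{n,m/2}}\int\bigl(U|0\rangle\otimes\overline U|0\rangle\bigr)^{\otimes m/2}\,dU\in\bigotimes_{i=1}^{m/2}(\mathcal H_{2i-1}\otimes\mathcal H_{2i}),$$ $$|\Phi\rangle:=\sqrt{2^n}\int U|0\rangle\otimes\overline U|0\rangle\,dU\in\mathbb C^{2^n}\otimes\mathbb C^{2^n},$$ $$\overline\rho:=\int \bigl(U|0\rangle\otimes\overline U|0\rangle\bigr)\bigl(\langle 0|U^\dagger\otimes\langle 0|\overline U^{\dagger}\bigr)\,dU .$$ Let $\rho:=|\Phi_m\rangle\langle\Phi_m|$,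 let $\rho|_{\mathcal H_1\otimes\mathcal H_2}$ be its reduced state on the first two sites, and let $\|\cdot\|_1$ be the trace norm $\|A\|_1=\mathrm{tr}\sqrt{A^\dagger A}$. A state on $\mathcal H_1\otimes\mathcal H_2$ is separable if it is a convex combination of product states. **Theorem.** (a) For all $n\ge 0$ and all positive even $m$: 1. $\rho$ is a state (a density operator) on $\bigl(\bigotimes_i\mathcal H_{2i-1}\bigr)^{\mathrm{sym}}\otimes\bigl(\bigotimes_i\mathcal H_{2i}\bigr)^{\mathrm{sym}}=(\mathbb C^{2^n})^{\odot m/2}\otimes(\mathbb C^{2^n})^{\odot m/2}$, and also on $(\mathbb C^{2^n}\otimes\mathbb C^{2^n})^{\odot m/2}$, where the $i$-th factor is $\mathcal H_{2i-1}\otimes\mathcal H_{2i}$. It is maximally entangled across the odd/even partition: the operator obtained from $|\Phi_m\rangle$ by turning the kets of the even sites into bras (partial transpose in the computational basis) is $\frac1{\sqrt{d_{n,m/2}}}$ times the orthogonal projector onto $(\mathbb C^{2^n})^{\odot m/2}$. 2. $\displaystyle \rho|_{\mathcal H_1\otimes\mathcal H_2}=\overline\rho+\frac2m\bigl(|\Phi\rangle\langle\Phi|-\overline\rho\bigr).$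 3. $\overline\rho$ is separable. 4. The minimum of $\bigl\|\rho|_{\mathcal H_1\otimes\mathcal H_2}-\sigma\bigr\|_1$ over the separable states $\sigma$ exists and is at most $\dfrac4m$. (b) Consequently, for every real polynomial $q$ with $q(n)>0$ for all integers $n\ge 0$, there is a polynomial $p$ with natural number coefficients such that, for all $n\ge 0$, the number $m=p(n)$ is positive and even and $$\min_{\sigma\ \mathrm{separable}}\bigl\|\rho|_{\mathcal H_1\otimes\mathcal H_2}-\sigma\bigr\|_1<\frac1{q(n)} .$$ -/

import Mathlib

open MeasureTheory
open scoped Matrix Kronecker ComplexOrder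

noncomputable section

namespace SymEnt

/-! ### The special unitary group and its Haar measure -/

/-- The group `SU(N)`. -/
abbrev SU (N : ℕ) := Matrix.specialUnitaryGroup (Fin N) ℂ

instance (N : ℕ) : IsTopologicalGroup (SU N) where
  continuous_inv :=
    Continuous.subtype_mk (continuous_star.comp continuous_subtype_val) _

instance (N : ℕ) : CompactSpace (SU N) := by
  suffices h : IsCompact (Matrix.specialUnitaryGroup (Fin N) ℂ : Set (Matrix (Fin N) (Fin N) ℂ)) from
    isCompact_iff_compactSpace.1 h
  have hK : IsCompact
      (Set.univ.pi fun _ : Fin N => Set.univ.pi fun _ : Fin N => Metric.closedBall (0 : ℂ) 1) :=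
    isCompact_univ_pi fun _ => isCompact_univ_pi fun _ => isCompact_closedBall _ _
  refine IsCompact.of_isClosed_subset hK ?_ ?_
  · have : (Matrix.specialUnitaryGroup (Fin N) ℂ : Set (Matrix (Fin N) (Fin N) ℂ))
        = {A | star A * A = 1} ∩ {A | A * star A = 1} ∩ {A | A.det = 1} := by
      ext A
      simp [Matrix.mem_specialUnitaryGroup_iff, Matrix.unitaryGroup, Unitary.mem_iff]
    rw [this]
    refine (IsClosed.inter ?_ ?_).inter ?_
    · exact isClosed_eq (by fun_prop) continuous_const
    · exact isClosed_eq (by fun_prop) continuous_const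
    · exact isClosed_eq (Continuous.matrix_det continuous_id) continuous_const
  · intro A hA i _ j _
    have := entry_norm_bound_of_unitary (Matrix.mem_specialUnitaryGroup_iff.1 hA).1 i j
    simpa using this

instance (N : ℕ) : MeasurableSpace (SU N) := borel _

instance (N : ℕ) : BorelSpace (SU N) := ⟨rfl⟩

/-- The Haar measure of `SU(N)`, normalized to total mass `1`. -/
def haarSU (N : ℕ) : Measure (SU N) := Measure.haarMeasure ⊤

/-! ### Vectors

The Hilbert space with orthonormal basis labelled by `ι` is `EuclideanSpace ℂ ι`; tensor products
are taken on the level of bases: `ι × κ` labels the product basis of a bipartite space, and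
`Fin k → ι` that of a `k`-fold tensor power. -/

/-- The product vector `a ⊗ b`. -/
def tensor {ι κ : Type*} (a : EuclideanSpace ℂ ι) (b : EuclideanSpace ℂ κ) :
    EuclideanSpace ℂ (ι × κ) :=
  WithLp.toLp 2 fun x => a x.1 * b x.2

/-- The tensor power `φ^{⊗ k}`. -/
def tensorPow {ι : Type*} (k : ℕ) (φ : EuclideanSpace ℂ ι) : EuclideanSpace ℂ (Fin k → ι) :=
  WithLp.toLp 2 fun x => ∏ i, φ (x i)

/-- The entrywise complex conjugate of a vector (in the computational basis). -/
def conjVec {ι : Type*} (φ : EuclideanSpace ℂ ι) : EuclideanSpace ℂ ι :=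
  WithLp.toLp 2 fun x => star (φ x)

/-- The symmetric subspace of the `k`-fold tensor power of `ℂ^ι`: the span of the vectors
`φ^{⊗ k}`. -/
def symSubspace (ι : Type*) [Fintype ι] (k : ℕ) : Submodule ℂ (EuclideanSpace ℂ (Fin k → ι)) :=
  Submodule.span ℂ (Set.range (tensorPow k))

/-- The dimension of the `k`-th symmetric power of `ℂ^ι`. -/
def symDim (ι : Type*) [Fintype ι] (k : ℕ) : ℕ := Module.finrank ℂ (symSubspace ι k)

/-- The orthogonal projector onto the symmetric subspace, i.e. the identity `I` of that subspace
seen as an operator on the whole tensor power. -/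
def symProj (ι : Type*) [Fintype ι] (k : ℕ) :
    EuclideanSpace ℂ (Fin k → ι) →ₗ[ℂ] EuclideanSpace ℂ (Fin k → ι) :=
  (symSubspace ι k).starProjection.toLinearMap

/-- For a vector `a` of the odd sites `1, 3, …, 2k-1` and a vector `b` of the even sites
`2, 4, …, 2k`, the vector `a ⊗ b` of all `2k` sites. The sites `2i-1` and `2i` are grouped into
the `i`-th pair, so that the `2k`-site space has basis `Fin k → ι × ι`. -/
def oddEven {ι : Type*} {k : ℕ} (a b : EuclideanSpace ℂ (Fin k → ι)) :
    EuclideanSpace ℂ (Fin k → ι × ι) :=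
  WithLp.toLp 2 fun x => a (fun i => (x i).1) * b (fun i => (x i).2)

/-- The tensor product of the symmetric subspace of the odd sites and the symmetric subspace of
the even sites. -/
def symOddEven (ι : Type*) [Fintype ι] (k : ℕ) :
    Submodule ℂ (EuclideanSpace ℂ (Fin k → ι × ι)) :=
  Submodule.span ℂ (Set.image2 oddEven
    (symSubspace ι k : Set (EuclideanSpace ℂ (Fin k → ι)))
    (symSubspace ι k : Set (EuclideanSpace ℂ (Fin k → ι))))

/-- The partial transpose of a vector with respect to the odd / even partition: the ket of the
even sites is turned into a bra. -/
def partialTranspose {ι : Type*} {k : ℕ} (ψ : EuclideanSpace ℂ (Fin k → ι × ι)) :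
    Matrix (Fin k → ι) (Fin k → ι) ℂ :=
  Matrix.of fun x y => ψ fun i => (x i, y i)

/-! ### States -/

/-- Density matrices. -/
def IsDensity {ι : Type*} [Fintype ι] (ρ : Matrix ι ι ℂ) : Prop :=
  ρ.PosSemidef ∧ ρ.trace = 1

/-- The states of the subspace `K`: density matrices whose range lies in `K`. -/
def IsStateOn {ι : Type*} [Fintype ι] [DecidableEq ι] (K : Submodule ℂ (EuclideanSpace ℂ ι))
    (ρ : Matrix ι ι ℂ) : Prop :=
  IsDensity ρ ∧ LinearMap.range (Matrix.toEuclideanLin ρ) ≤ K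

/-- The rank one operator `|ψ⟩⟨ψ|`. -/
def ketBra {ι : Type*} (ψ : EuclideanSpace ℂ ι) : Matrix ι ι ℂ :=
  Matrix.of fun x y => ψ x * star (ψ y)

/-- Separable states of a bipartite system: convex combinations of product states. -/
def separableStates (ι κ : Type*) [Fintype ι] [Fintype κ] : Set (Matrix (ι × κ) (ι × κ) ℂ) :=
  convexHull ℝ {σ | ∃ (A : Matrix ι ι ℂ) (B : Matrix κ κ ℂ), IsDensity A ∧ IsDensity B ∧
    σ = A ⊗ₖ B}

/-- The configuration of `k` systems whose first system is in `a` and whose other systems are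
in `z`. -/
def extendFirst {ι : Type*} {k : ℕ} (a : ι) (z : {i : Fin k // i.val ≠ 0} → ι) : Fin k → ι :=
  fun i => if h : i.val = 0 then a else z ⟨i, h⟩

/-- The reduced state of the first of `k` systems: partial trace over the other ones. When the
systems are pairs of sites, this is the reduced state of the first two sites. -/
def reduceFirst {ι : Type*} [Fintype ι] {k : ℕ} (ρ : Matrix (Fin k → ι) (Fin k → ι) ℂ) :
    Matrix ι ι ℂ :=
  Matrix.of fun a b =>
    ∑ z : {i : Fin k // i.val ≠ 0} → ι, ρ (extendFirst a z) (extendFirst b z)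

/-- The trace norm `tr √(Aᴴ A)`, that is, the sum of the singular values. -/
def traceNorm {ι : Type*} [Fintype ι] [DecidableEq ι] (A : Matrix ι ι ℂ) : ℝ :=
  ∑ i, Real.sqrt ((Matrix.isHermitian_conjTranspose_mul_self A).eigenvalues i)

/-- `r` is the minimum of the trace distances `‖ρ - σ‖₁` over all separable states `σ`. -/
def IsMinDistSep {ι κ : Type*} [Fintype ι] [Fintype κ] [DecidableEq ι] [DecidableEq κ]
    (ρ : Matrix (ι × κ) (ι × κ) ℂ) (r : ℝ) : Prop :=
  IsLeast ((fun σ => traceNorm (ρ - σ)) '' separableStates ι κ) r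

/-! ### The symmetric maximally entangled state -/

/-- The vector `U|0⟩` of `ℂ^N`. -/
def rotZero (N : ℕ) [NeZero N] (U : SU N) : EuclideanSpace ℂ (Fin N) :=
  WithLp.toLp 2 fun i => U.1 i 0

/-- The vector `U|0⟩ ⊗ Ū|0⟩`. -/
def rotPair (N : ℕ) [NeZero N] (U : SU N) : EuclideanSpace ℂ (Fin N × Fin N) :=
  tensor (rotZero N U) (conjVec (rotZero N U))

/-- The vector `√d ∫ (U|0⟩ ⊗ Ū|0⟩)^{⊗ k} dU` of `2k` sites, where `d` is the dimension of the
`k`-th symmetric power of `ℂ^N`. -/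
def symMaxEnt (N k : ℕ) [NeZero N] : EuclideanSpace ℂ (Fin k → Fin N × Fin N) :=
  ((Real.sqrt (symDim (Fin N) k : ℝ) : ℝ) : ℂ) • ∫ U, tensorPow k (rotPair N U) ∂(haarSU N)

/-- The vector `√N ∫ U|0⟩ ⊗ Ū|0⟩ dU` of two sites. -/
def maxEnt (N : ℕ) [NeZero N] : EuclideanSpace ℂ (Fin N × Fin N) :=
  ((Real.sqrt (N : ℝ) : ℝ) : ℂ) • ∫ U, rotPair N U ∂(haarSU N)

/-- The average of the projectors onto `U|0⟩ ⊗ Ū|0⟩`. -/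
def rhoBar (N : ℕ) [NeZero N] : Matrix (Fin N × Fin N) (Fin N × Fin N) ℂ :=
  Matrix.of fun x y => ∫ U, ketBra (rotPair N U) x y ∂(haarSU N)

/-- The reduced state of the first two sites of the `m`-site state `|Φ⟩⟨Φ|`, `m` even, where
each site is `ℂ^{2^n}`. -/
def twoSite (n m : ℕ) : Matrix (Fin (2 ^ n) × Fin (2 ^ n)) (Fin (2 ^ n) × Fin (2 ^ n)) ℂ :=
  reduceFirst (ketBra (symMaxEnt (2 ^ n) (m / 2)))

end SymEnt

end

open MeasureTheory
open scoped Matrix Kronecker ComplexOrder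

noncomputable section

namespace SymEnt

/-! Write φ = U|0⟩ and k = m/2. Turning the even kets of (φ ⊗ φ̄)^{⊗k} into bras gives the projector
onto φ^{⊗k}, so everything rests on the Haar moment ∫ (φφ†)^{⊗k} dU being the projector onto the
symmetric subspace divided by its dimension d (`toEuclideanLin_haarMoment`). Invariance fixes its
quadratic form on tensor powers up to a constant, `polarization` then gives all matrix elements
between them, and the trace gives the constant 1/d.

For the reduced state, one of the two copies of Φ_m is expanded as a Haar integral and contracted
with the other over all pairs but the first (`sum_tensorPow_mul_star_symMaxEnt`). The contraction is
a matrix element of the symmetric projector between product vectors that equal φ in all slots but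
one. Projecting averages over the position of the odd slot (`symProj_prodVec_update`): with weight
1/k the two exceptional slots meet and yield |Φ⟩⟨Φ|, otherwise they yield the integrand of ρ̄.

Since ρ̄ is an average of product states and the separable states are compact and convex, ρ̄ is
separable and the minimum is attained. Its value is at most (2/m)‖|Φ⟩⟨Φ| - ρ̄‖₁ ≤ 4/m, which a
polynomial m pushes below 1/q. -/

/-! ### Haar measure and transitivity on the sphere -/

instance (N : ℕ) : IsProbabilityMeasure (haarSU N) :=
  ⟨by simpa using! Measure.haarMeasure_self (K₀ := (⊤ : TopologicalSpace.PositiveCompacts (SU N)))⟩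

instance (N : ℕ) : (haarSU N).IsMulLeftInvariant := by
  unfold haarSU; infer_instance

theorem integrable_haarSU {N : ℕ} {E : Type*} [NormedAddCommGroup E] {f : SU N → E}
    (hf : Continuous f) : Integrable f (haarSU N) :=
  hf.integrable_of_hasCompactSupport (HasCompactSupport.of_compactSpace f)

/-- Up to a phase, `SU(N)` acts transitively on the unit sphere. -/
theorem exists_smul_rotZero (N : ℕ) [NeZero N] (ψ : EuclideanSpace ℂ (Fin N)) :
    ∃ (V : SU N) (z : ℂ), ψ = z • rotZero N V := by
  obtain ⟨r, u, hu, rfl⟩ : ∃ (r : ℂ) (u : EuclideanSpace ℂ (Fin N)), ‖u‖ = 1 ∧ ψ = r • u := by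
    by_cases h : ψ = 0
    · exact ⟨0, EuclideanSpace.single 0 1, by simp, by simp [h]⟩
    · exact ⟨‖ψ‖, (‖ψ‖⁻¹ : ℂ) • ψ, by simp [norm_smul, h], by simp [smul_smul, h]⟩
  obtain ⟨b, hb⟩ := Orthonormal.exists_orthonormalBasis_extension_of_card_eq (𝕜 := ℂ)
    (E := EuclideanSpace ℂ (Fin N)) (ι := Fin N) (by simp) (v := fun _ => u) (s := {0})
    (by
      rw [orthonormal_iff_ite]
      rintro ⟨i, rfl⟩ ⟨j, rfl⟩
      simp [hu])
  have hV := (EuclideanSpace.basisFun (Fin N) ℂ).toMatrix_orthonormalBasis_mem_unitary b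
  set V := (EuclideanSpace.basisFun (Fin N) ℂ).toBasis.toMatrix b
  have hdet : ‖V.det‖ = 1 :=
    CStarRing.norm_of_mem_unitary (Matrix.det_of_mem_unitary hV)
  -- Rescaling V by an N-th root of 1/det V makes the determinant 1; the phase is absorbed into the
  -- scalar z.
  obtain ⟨l, hl⟩ := IsAlgClosed.exists_pow_nat_eq (V.det)⁻¹ (NeZero.pos N)
  have hl1 : ‖l‖ = 1 := by
    have : ‖l‖ ^ N = 1 := by rw [← norm_pow, hl, norm_inv, hdet, inv_one]
    exact (pow_eq_one_iff_of_nonneg (norm_nonneg _) (NeZero.ne N)).1 this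
  have hd0 : V.det ≠ 0 := by intro h; simp [h] at hdet
  have hl0 : l ≠ 0 := by intro h; simp [h] at hl1
  refine ⟨⟨l • V, ?_⟩, r * l⁻¹, ?_⟩
  · rw [Matrix.mem_specialUnitaryGroup_iff, Matrix.mem_unitaryGroup_iff', Matrix.det_smul,
      Fintype.card_fin, hl, inv_mul_cancel₀ hd0]
    refine ⟨?_, rfl⟩
    rw [star_smul, smul_mul_smul_comm, Matrix.mem_unitaryGroup_iff'.1 hV]
    have : star l * l = 1 := by
      rw [Complex.star_def, Complex.conj_mul', hl1]; simp
    rw [this, one_smul]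
  · ext i
    have := congrArg (fun v => v i) (hb 0 rfl)
    simp only at this
    simp [rotZero, V, Module.Basis.toMatrix_apply, this]
    field_simp

/-! ### Polarization by analytic continuation -/

/-- Identity theorem: the real zeros accumulate at 0. -/
theorem eq_zero_of_forall_real {f : ℂ → ℂ} (hf : Differentiable ℂ f)
    (h : ∀ x : ℝ, f x = 0) (z : ℂ) : f z = 0 := by
  have hA : AnalyticOnNhd ℂ f Set.univ := fun z _ => hf.analyticAt z
  refine hA.eqOn_zero_of_preconnected_of_frequently_eq_zero isPreconnected_univ
    (Set.mem_univ (0 : ℂ)) ?_ (Set.mem_univ z)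
  have hr : ∃ᶠ x : ℝ in nhdsWithin 0 {0}ᶜ, f (x : ℂ) = 0 :=
    (Filter.Eventually.of_forall h).frequently
  have ht : Filter.Tendsto (fun x : ℝ => (x : ℂ)) (nhdsWithin 0 {0}ᶜ) (nhdsWithin 0 {0}ᶜ) := by
    refine tendsto_nhdsWithin_of_tendsto_nhds_of_eventually_within _ ?_ ?_
    · exact (Complex.continuous_ofReal.tendsto' 0 0 (by simp)).mono_left nhdsWithin_le_nhds
    · filter_upwards [self_mem_nhdsWithin] with x hx
      simpa using hx
  exact ht.frequently hr

/-- An entire function of `(u, v)` that vanishes whenever `u` is the conjugate of `v`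
vanishes identically. -/
theorem polarization {ι : Type*} [Fintype ι] {F : (ι → ℂ) → (ι → ℂ) → ℂ}
    (hF : Differentiable ℂ fun p : (ι → ℂ) × (ι → ℂ) => F p.1 p.2)
    (h : ∀ v : ι → ℂ, F (star v) v = 0) (u v : ι → ℂ) : F u v = 0 := by
  let re (a : ι → ℂ) : ι → ℂ := fun i => ((a i).re : ℂ)
  let im (a : ι → ℂ) : ι → ℂ := fun i => ((a i).im : ℂ)
  have hF' : ∀ (p q : ℂ → ι → ℂ), Differentiable ℂ p → Differentiable ℂ q →
      Differentiable ℂ fun z => F (p z) (q z) := fun p q hp hq => hF.comp (hp.prodMk hq)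
  have hreim : ∀ a : ι → ℂ, re a + Complex.I • im a = a := by
    intro a; ext i; simp [re, im, mul_comm Complex.I, Complex.re_add_im]
  -- In the coordinates u = a - ib, v = a + ib the hypothesis covers real a and b. First a is made
  -- complex, then b: F vanishes at all real points of the line re a + z im a, hence also at z = i.
  have h1 : ∀ (a b : ι → ℂ), F (a - Complex.I • re b) (a + Complex.I • re b) = 0 := by
    intro a b
    have := eq_zero_of_forall_real
      (f := fun z => F ((re a + z • im a) - Complex.I • re b)
        ((re a + z • im a) + Complex.I • re b))
      (hF' _ _ (by fun_prop) (by fun_prop)) (fun x => by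
        convert h ((re a + (x : ℂ) • im a) + Complex.I • re b) using 2
        ext i
        simp [re, im]
        ring) Complex.I
    simpa only [hreim] using this
  have h2 : ∀ (a b : ι → ℂ), F (a - Complex.I • b) (a + Complex.I • b) = 0 := by
    intro a b
    have := eq_zero_of_forall_real
      (f := fun z => F (a - Complex.I • (re b + z • im b)) (a + Complex.I • (re b + z • im b)))
      (hF' _ _ (by fun_prop) (by fun_prop)) (fun x => by
        convert h1 a (re b + (x : ℂ) • im b) using 4 <;>
        · ext i
          simp [re, im]) Complex.I
    simpa only [hreim] using this
  have hu : (1 / 2 : ℂ) • (u + v) - Complex.I • ((Complex.I / 2) • (u - v)) = u := by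
    ext i
    simp only [Pi.add_apply, Pi.sub_apply, Pi.smul_apply, smul_eq_mul]
    linear_combination (-(u i - v i) / 2) * Complex.I_mul_I
  have hv : (1 / 2 : ℂ) • (u + v) + Complex.I • ((Complex.I / 2) • (u - v)) = v := by
    ext i
    simp only [Pi.add_apply, Pi.sub_apply, Pi.smul_apply, smul_eq_mul]
    linear_combination ((u i - v i) / 2) * Complex.I_mul_I
  simpa only [hu, hv] using h2 ((1 / 2 : ℂ) • (u + v)) ((Complex.I / 2) • (u - v))

/-! ### Haar moments and the symmetric projector -/

theorem inner_eq_sum {ι : Type*} [Fintype ι] (v w : EuclideanSpace ℂ ι) :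
    inner ℂ v w = ∑ i, star (v i) * w i := by
  simp [PiLp.inner_apply, mul_comm]

theorem inner_tensorPow {ι : Type*} [Fintype ι] (k : ℕ) (φ χ : EuclideanSpace ℂ ι) :
    inner ℂ (tensorPow k φ) (tensorPow k χ) = inner ℂ φ χ ^ k := by
  classical
  simp only [inner_eq_sum, Fintype.sum_pow, tensorPow, star_prod, Finset.prod_mul_distrib]

@[fun_prop]
theorem continuous_tensorPow {ι : Type*} [Fintype ι] (k : ℕ) :
    Continuous (tensorPow k : EuclideanSpace ℂ ι → _) := by
  unfold tensorPow
  fun_prop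

@[fun_prop]
theorem continuous_rotZero (N : ℕ) [NeZero N] : Continuous (rotZero N) := by
  unfold rotZero
  refine (PiLp.continuous_toLp 2 _).comp (continuous_pi fun i => ?_)
  exact (continuous_apply_apply i 0).comp continuous_subtype_val

theorem inner_rotZero (N : ℕ) [NeZero N] (V U : SU N) :
    inner ℂ (rotZero N V) (rotZero N U) = (V⁻¹ * U).1 0 0 := by
  rw [inner_eq_sum]
  simp only [rotZero]
  change _ = (star V.1 * U.1) 0 0
  simp [Matrix.mul_apply, Matrix.star_apply]

theorem inner_rotZero_self (N : ℕ) [NeZero N] (U : SU N) :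
    inner ℂ (rotZero N U) (rotZero N U) = 1 := by
  rw [inner_rotZero]
  simp

/-- The moments `∫ φ^{⊗ k} (φ^{⊗ k})† dU` of the vector `φ = U|0⟩`. -/
def haarMoment (N k : ℕ) [NeZero N] : Matrix (Fin k → Fin N) (Fin k → Fin N) ℂ :=
  Matrix.of fun x y => ∫ U, ketBra (tensorPow k (rotZero N U)) x y ∂(haarSU N)

theorem continuous_ketBra {ι : Type*} [Fintype ι] (x y : ι) :
    Continuous fun ψ : EuclideanSpace ℂ ι => ketBra ψ x y := by
  simp only [ketBra, Matrix.of_apply]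
  fun_prop

theorem integrable_ketBra_tensorPow {N k : ℕ} [NeZero N] (x y : Fin k → Fin N) :
    Integrable (fun U => ketBra (tensorPow k (rotZero N U)) x y) (haarSU N) :=
  integrable_haarSU ((continuous_ketBra x y).comp (by fun_prop))

theorem inner_haarMoment (N k : ℕ) [NeZero N] (w v : EuclideanSpace ℂ (Fin k → Fin N)) :
    inner ℂ w (Matrix.toEuclideanLin (haarMoment N k) v) =
      ∫ U, inner ℂ w (tensorPow k (rotZero N U)) *
        inner ℂ (tensorPow k (rotZero N U)) v ∂(haarSU N) := by
  have hc := integrable_ketBra_tensorPow (N := N) (k := k)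
  have : ∀ U, inner ℂ w (tensorPow k (rotZero N U)) * inner ℂ (tensorPow k (rotZero N U)) v =
      ∑ x, ∑ y, star (w x) * (ketBra (tensorPow k (rotZero N U)) x y * v y) := by
    intro U
    simp only [inner_eq_sum, Finset.sum_mul_sum, ketBra, Matrix.of_apply]
    refine Finset.sum_congr rfl fun x _ => Finset.sum_congr rfl fun y _ => ?_
    ring
  simp only [this]
  rw [integral_finsetSum _ fun x _ => integrable_finsetSum _ fun y _ =>
    ((hc x y).mul_const _).const_mul _]
  simp_rw [fun x => integral_finsetSum (μ := haarSU N) Finset.univ fun y _ =>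
    ((hc x y).mul_const (v y)).const_mul (star (w x)), integral_const_mul, integral_mul_const]
  simp only [inner_eq_sum, Matrix.toLpLin_apply, Matrix.mulVec, dotProduct, Finset.mul_sum]
  rfl

/-- The `2k`-th absolute moment of a matrix entry. -/
def entryMoment (N k : ℕ) [NeZero N] : ℂ :=
  ∫ U : SU N, U.1 0 0 ^ k * star (U.1 0 0) ^ k ∂(haarSU N)

/-- With ψ = z V|0⟩, left invariance of the Haar measure removes V, so that only the norm of ψ
matters. -/
theorem inner_haarMoment_tensorPow_self (N k : ℕ) [NeZero N] (ψ : EuclideanSpace ℂ (Fin N)) :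
    inner ℂ (tensorPow k ψ) (Matrix.toEuclideanLin (haarMoment N k) (tensorPow k ψ)) =
      entryMoment N k * inner ℂ ψ ψ ^ k := by
  obtain ⟨V, z, rfl⟩ := exists_smul_rotZero N ψ
  rw [inner_haarMoment]
  have : ∀ U, inner ℂ (tensorPow k (z • rotZero N V)) (tensorPow k (rotZero N U)) *
      inner ℂ (tensorPow k (rotZero N U)) (tensorPow k (z • rotZero N V)) =
      (star z * z) ^ k * ((V⁻¹ * U).1 0 0 ^ k * star ((V⁻¹ * U).1 0 0) ^ k) := by
    intro U
    rw [inner_tensorPow, inner_tensorPow, ← inner_conj_symm (rotZero N U), inner_smul_left,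
      inner_rotZero, map_mul, Complex.conj_conj]
    simp only [Complex.star_def]
    ring
  simp only [this]
  rw [integral_const_mul, integral_mul_left_eq_self
    (fun U : SU N => U.1 0 0 ^ k * star (U.1 0 0) ^ k), inner_smul_left, inner_smul_right,
    inner_rotZero_self, mul_one, mul_comm]
  rfl

/-- Both sides are polynomials in (χ̄, ψ), so the case χ = ψ suffices by `polarization`. -/
theorem inner_haarMoment_tensorPow (N k : ℕ) [NeZero N] (χ ψ : EuclideanSpace ℂ (Fin N)) :
    inner ℂ (tensorPow k χ) (Matrix.toEuclideanLin (haarMoment N k) (tensorPow k ψ)) =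
      entryMoment N k * inner ℂ χ ψ ^ k := by
  let F : (Fin N → ℂ) → (Fin N → ℂ) → ℂ := fun u v =>
    (∑ x : Fin k → Fin N, (∏ i, u (x i)) * ∑ y : Fin k → Fin N, haarMoment N k x y * ∏ i, v (y i)) -
      entryMoment N k * (∑ i, u i * v i) ^ k
  have hF : ∀ χ ψ : EuclideanSpace ℂ (Fin N), F (star ⇑χ) ⇑ψ =
      inner ℂ (tensorPow k χ) (Matrix.toEuclideanLin (haarMoment N k) (tensorPow k ψ)) -
      entryMoment N k * inner ℂ χ ψ ^ k := by
    intro χ ψ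
    simp [F, inner_eq_sum, Matrix.toLpLin_apply, Matrix.mulVec, dotProduct, tensorPow]
  rw [← sub_eq_zero, ← hF]
  refine polarization (by unfold F; fun_prop) (fun v => ?_) _ _
  have := hF (WithLp.toLp 2 v) (WithLp.toLp 2 v)
  rw [inner_haarMoment_tensorPow_self, sub_self] at this
  exact this

theorem tensorPow_mem_symSubspace {ι : Type*} [Fintype ι] (k : ℕ) (φ : EuclideanSpace ℂ ι) :
    tensorPow k φ ∈ symSubspace ι k :=
  Submodule.subset_span ⟨φ, rfl⟩

theorem symProj_tensorPow {ι : Type*} [Fintype ι] (k : ℕ) (φ : EuclideanSpace ℂ ι) :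
    symProj ι k (tensorPow k φ) = tensorPow k φ :=
  Submodule.starProjection_eq_self_iff.2 (tensorPow_mem_symSubspace k φ)

theorem inner_symProj_left {ι : Type*} [Fintype ι] (k : ℕ) (v w : EuclideanSpace ℂ (Fin k → ι)) :
    inner ℂ (symProj ι k v) w = inner ℂ v (symProj ι k w) :=
  Submodule.inner_starProjection_left_eq_right _ v w

theorem symProj_mem {ι : Type*} [Fintype ι] (k : ℕ) (v : EuclideanSpace ℂ (Fin k → ι)) :
    symProj ι k v ∈ symSubspace ι k :=
  Submodule.starProjection_apply_mem _ v

theorem symProj_of_mem {ι : Type*} [Fintype ι] {k : ℕ} {v : EuclideanSpace ℂ (Fin k → ι)}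
    (hv : v ∈ symSubspace ι k) : symProj ι k v = v :=
  Submodule.starProjection_eq_self_iff.2 hv

/-- Sesquilinearity extends the matrix elements from tensor powers to their span. Outside it nothing
is left to check, because the integrand sees a vector only through its symmetric projection. -/
theorem toEuclideanLin_haarMoment_eq_entryMoment_smul (N k : ℕ) [NeZero N] :
    Matrix.toEuclideanLin (haarMoment N k) = entryMoment N k • symProj (Fin N) k := by
  set M := Matrix.toEuclideanLin (haarMoment N k) with hM
  have hsym : ∀ w ∈ symSubspace (Fin N) k, ∀ v ∈ symSubspace (Fin N) k,
      inner ℂ w (M v) = entryMoment N k * inner ℂ w v := by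
    intro w hw v hv
    induction hw using Submodule.span_induction with
    | mem w hw =>
      obtain ⟨χ, rfl⟩ := hw
      induction hv using Submodule.span_induction with
      | mem v hv =>
        obtain ⟨ψ, rfl⟩ := hv
        rw [inner_haarMoment_tensorPow, inner_tensorPow]
      | zero => simp
      | add a b _ _ ha hb => rw [map_add, inner_add_right, inner_add_right, ha, hb, mul_add]
      | smul c a _ ha => rw [map_smul, inner_smul_right, inner_smul_right, ha]; ring
    | zero => simp
    | add a b _ _ ha hb => rw [inner_add_left, inner_add_left, ha, hb, mul_add]
    | smul c a _ ha => rw [inner_smul_left, inner_smul_left, ha]; ring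
  refine LinearMap.ext fun v => ext_inner_left ℂ fun w => ?_
  have : inner ℂ w (M v) = inner ℂ (symProj (Fin N) k w) (M (symProj (Fin N) k v)) := by
    rw [hM, inner_haarMoment, inner_haarMoment]
    congr 1 with U
    rw [inner_symProj_left, ← inner_symProj_left k _ v, symProj_tensorPow]
  rw [this, hsym _ (symProj_mem k w) _ (symProj_mem k v), inner_symProj_left,
    symProj_of_mem (symProj_mem k v), LinearMap.smul_apply, inner_smul_right]

/-- Take traces: each integrand is a projector of trace 1, and the trace of the symmetric projector
is its rank. -/
theorem entryMoment_mul_symDim (N k : ℕ) [NeZero N] :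
    entryMoment N k * symDim (Fin N) k = 1 := by
  have h1 : LinearMap.trace ℂ _ (symProj (Fin N) k) = symDim (Fin N) k :=
    LinearMap.IsProj.trace (p := symSubspace (Fin N) k)
      ⟨symProj_mem k, fun v hv => symProj_of_mem hv⟩
  have h2 := congrArg (LinearMap.trace ℂ _) (toEuclideanLin_haarMoment_eq_entryMoment_smul N k)
  rw [map_smul, h1, smul_eq_mul] at h2
  rw [← h2, LinearMap.trace_eq_sum_inner _ (EuclideanSpace.basisFun _ ℂ)]
  have : ∀ x : Fin k → Fin N, inner ℂ (EuclideanSpace.basisFun _ ℂ x)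
      (Matrix.toEuclideanLin (haarMoment N k) (EuclideanSpace.basisFun _ ℂ x)) =
      haarMoment N k x x := by
    intro x
    simp [EuclideanSpace.inner_single_left, Matrix.toLpLin_apply]
  rw [Finset.sum_congr rfl fun x _ => this x]
  simp only [haarMoment, Matrix.of_apply]
  rw [← integral_finsetSum _ fun x _ => 
    integrable_ketBra_tensorPow x x]
  have : ∀ U, ∑ x, ketBra (tensorPow k (rotZero N U)) x x = 1 := by
    intro U
    have := inner_tensorPow k (rotZero N U) (rotZero N U)
    rw [inner_rotZero_self, one_pow, inner_eq_sum] at this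
    rw [← this]
    simp [ketBra, mul_comm]
  simp [this]

/-- The Haar moments are the multiple of the projector onto the symmetric subspace
that has trace one. -/
theorem toEuclideanLin_haarMoment (N k : ℕ) [NeZero N] :
    Matrix.toEuclideanLin (haarMoment N k) = (symDim (Fin N) k : ℂ)⁻¹ • symProj (Fin N) k := by
  rw [toEuclideanLin_haarMoment_eq_entryMoment_smul, eq_inv_of_mul_eq_one_left (entryMoment_mul_symDim N k)]

theorem symDim_ne_zero (N k : ℕ) [NeZero N] : (symDim (Fin N) k : ℂ) ≠ 0 :=
  right_ne_zero_of_mul_eq_one (entryMoment_mul_symDim N k)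

/-! ### The symmetric maximally entangled vector -/

@[fun_prop]
theorem continuous_rotPair (N : ℕ) [NeZero N] : Continuous (rotPair N) := by
  refine (PiLp.continuous_toLp 2 _).comp (continuous_pi fun x => ?_)
  have h : ∀ i, Continuous fun U => rotZero N U i := fun i =>
    (PiLp.continuous_apply 2 _ i).comp (continuous_rotZero N)
  exact (h x.1).mul (h x.2).star

theorem integral_apply {N : ℕ} {ι : Type*} [Fintype ι] {f : SU N → EuclideanSpace ℂ ι}
    (hf : Continuous f) (x : ι) : (∫ U, f U ∂(haarSU N)) x = ∫ U, f U x ∂(haarSU N) :=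
  ((EuclideanSpace.proj (𝕜 := ℂ) x).integral_comp_comm (integrable_haarSU hf)).symm

theorem tensorPow_rotPair (N k : ℕ) [NeZero N] (U : SU N) (x : Fin k → Fin N × Fin N) :
    tensorPow k (rotPair N U) x =
      ketBra (tensorPow k (rotZero N U)) (fun i => (x i).1) (fun i => (x i).2) := by
  simp [tensorPow, rotPair, tensor, conjVec, ketBra, Finset.prod_mul_distrib]

theorem symMaxEnt_apply (N k : ℕ) [NeZero N] (x : Fin k → Fin N × Fin N) :
    symMaxEnt N k x = ((Real.sqrt (symDim (Fin N) k) : ℝ) : ℂ) *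
      haarMoment N k (fun i => (x i).1) (fun i => (x i).2) := by
  rw [symMaxEnt, PiLp.smul_apply, integral_apply (by fun_prop), smul_eq_mul]
  simp only [tensorPow_rotPair, haarMoment, Matrix.of_apply]

theorem sqrt_symDim_mul_self (N k : ℕ) :
    ((Real.sqrt (symDim (Fin N) k) : ℝ) : ℂ) * ((Real.sqrt (symDim (Fin N) k) : ℝ) : ℂ) =
      symDim (Fin N) k := by
  rw [← Complex.ofReal_mul, Real.mul_self_sqrt (by positivity)]
  simp

theorem sqrt_symDim_ne_zero (N k : ℕ) [NeZero N] :
    ((Real.sqrt (symDim (Fin N) k) : ℝ) : ℂ) ≠ 0 := by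
  intro h
  have := sqrt_symDim_mul_self N k
  rw [h, zero_mul] at this
  exact symDim_ne_zero N k this.symm

theorem sqrt_symDim_mul_inv (N k : ℕ) [NeZero N] :
    ((Real.sqrt (symDim (Fin N) k) : ℝ) : ℂ) * (symDim (Fin N) k : ℂ)⁻¹ =
      1 / ((Real.sqrt (symDim (Fin N) k) : ℝ) : ℂ) := by
  have := sqrt_symDim_ne_zero N k
  rw [← sqrt_symDim_mul_self N k]
  field_simp

theorem toEuclideanLin_partialTranspose_symMaxEnt (N k : ℕ) [NeZero N] :
    Matrix.toEuclideanLin (partialTranspose (symMaxEnt N k)) =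
      (1 / ((Real.sqrt (symDim (Fin N) k : ℝ) : ℝ) : ℂ)) • symProj (Fin N) k := by
  have : partialTranspose (symMaxEnt N k) =
      ((Real.sqrt (symDim (Fin N) k) : ℝ) : ℂ) • haarMoment N k := by
    ext x y
    simp [partialTranspose, symMaxEnt_apply]
  rw [this, map_smul, toEuclideanLin_haarMoment, smul_smul, sqrt_symDim_mul_inv]

/-- The overlap of the symmetric maximally entangled vector with a product `a ⊗ b̄`. -/
theorem sum_mul_symMaxEnt (N k : ℕ) [NeZero N] (a b : EuclideanSpace ℂ (Fin k → Fin N)) :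
    ∑ x, star (a fun i => (x i).1) * b (fun i => (x i).2) * symMaxEnt N k x =
      (1 / ((Real.sqrt (symDim (Fin N) k : ℝ) : ℝ) : ℂ)) * inner ℂ a (symProj (Fin N) k b) := by
  -- Regrouping k pairs as a pair of k-tuples turns the sum into a matrix element of the partial
  -- transpose.
  rw [← inner_smul_right, ← LinearMap.smul_apply, ← toEuclideanLin_partialTranspose_symMaxEnt,
    inner_eq_sum, ← (Equiv.arrowProdEquivProdArrow (Fin k) (fun _ => Fin N)
      (fun _ => Fin N)).symm.sum_comp, Fintype.sum_prod_type]
  refine Finset.sum_congr rfl fun x _ => ?_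
  simp only [Matrix.toLpLin_apply, Matrix.mulVec, dotProduct, Finset.mul_sum]
  refine Finset.sum_congr rfl fun y _ => ?_
  simp only [partialTranspose, Matrix.of_apply, Equiv.arrowProdEquivProdArrow]
  simp
  ring

theorem isDensity_ketBra {ι : Type*} [Fintype ι] {ψ : EuclideanSpace ℂ ι}
    (h : inner ℂ ψ ψ = 1) : IsDensity (ketBra ψ) := by
  constructor
  · exact Matrix.posSemidef_vecMulVec_self_star ⇑ψ
  · rw [← h, inner_eq_sum]
    simp [Matrix.trace, ketBra, mul_comm]

theorem isStateOn_ketBra {ι : Type*} [Fintype ι] [DecidableEq ι] {ψ : EuclideanSpace ℂ ι}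
    (h : inner ℂ ψ ψ = 1) {K : Submodule ℂ (EuclideanSpace ℂ ι)} (hK : ψ ∈ K) :
    IsStateOn K (ketBra ψ) := by
  refine ⟨isDensity_ketBra h, ?_⟩
  rintro _ ⟨v, rfl⟩
  have : Matrix.toEuclideanLin (ketBra ψ) v = inner ℂ ψ v • ψ := by
    ext x
    simp only [Matrix.toLpLin_apply, Matrix.mulVec, dotProduct, ketBra, inner_eq_sum,
      Matrix.of_apply, PiLp.smul_apply, smul_eq_mul, Finset.sum_mul]
    refine Finset.sum_congr rfl fun y _ => ?_
    ring
  rw [this]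
  exact K.smul_mem _ hK

/-- The overlap with every integrand (φ ⊗ φ̄)^{⊗k} is the constant 1/√d, which the prefactor √d
cancels. -/
theorem inner_symMaxEnt_self (N k : ℕ) [NeZero N] :
    inner ℂ (symMaxEnt N k) (symMaxEnt N k) = 1 := by
  have h : ∀ U, inner ℂ (symMaxEnt N k) (tensorPow k (rotPair N U)) =
      1 / ((Real.sqrt (symDim (Fin N) k : ℝ) : ℝ) : ℂ) := by
    intro U
    have := sum_mul_symMaxEnt N k (tensorPow k (rotZero N U)) (tensorPow k (rotZero N U))
    rw [symProj_tensorPow, inner_tensorPow, inner_rotZero_self, one_pow, mul_one] at this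
    rw [← inner_conj_symm, inner_eq_sum, ← Complex.conj_ofReal (Real.sqrt _),
      ← map_one (starRingEnd ℂ), ← map_div₀, ← this]
    simp only [tensorPow_rotPair, ketBra, Matrix.of_apply, star_mul', star_star]
  conv_lhs => enter [3]; rw [symMaxEnt]
  rw [inner_smul_right]
  have hi := (innerSL ℂ (symMaxEnt N k)).integral_comp_comm
    (integrable_haarSU (N := N) (f := fun U => tensorPow k (rotPair N U)) (by fun_prop))
  simp only [innerSL_apply_apply] at hi
  rw [← hi]
  simp only [h]
  have := sqrt_symDim_ne_zero N k
  simp [this]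

theorem integral_mem_submodule {N : ℕ} {ι : Type*} [Fintype ι] {f : SU N → EuclideanSpace ℂ ι}
    (hf : Continuous f) {K : Submodule ℂ (EuclideanSpace ℂ ι)} (hK : ∀ U, f U ∈ K) :
    ∫ U, f U ∂(haarSU N) ∈ K :=
  (K.restrictScalars ℝ).convex.integral_mem K.closed_of_finiteDimensional
    (Filter.Eventually.of_forall hK) (integrable_haarSU hf)

theorem symMaxEnt_mem_symSubspace (N k : ℕ) [NeZero N] :
    symMaxEnt N k ∈ symSubspace (Fin N × Fin N) k :=
  Submodule.smul_mem _ _ <|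
    integral_mem_submodule (by fun_prop) fun _ => tensorPow_mem_symSubspace _ _

theorem symMaxEnt_mem_symOddEven (N k : ℕ) [NeZero N] :
    symMaxEnt N k ∈ symOddEven (Fin N) k := by
  refine Submodule.smul_mem _ _ <| integral_mem_submodule (by fun_prop) fun U =>
    Submodule.subset_span ⟨_, tensorPow_mem_symSubspace k (rotZero N U), _,
      tensorPow_mem_symSubspace k (conjVec (rotZero N U)), ?_⟩
  ext x
  simp [oddEven, tensorPow, rotPair, tensor, Finset.prod_mul_distrib]

/-! ### The two-site reduced state -/

/-- The product vector of a family of vectors. -/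
def prodVec {ι : Type*} {k : ℕ} (f : Fin k → EuclideanSpace ℂ ι) :
    EuclideanSpace ℂ (Fin k → ι) :=
  WithLp.toLp 2 fun x => ∏ i, f i (x i)

theorem inner_prodVec {ι : Type*} [Fintype ι] {k : ℕ} (f g : Fin k → EuclideanSpace ℂ ι) :
    inner ℂ (prodVec f) (prodVec g) = ∏ i, inner ℂ (f i) (g i) := by
  classical
  simp only [inner_eq_sum, Finset.prod_univ_sum, Fintype.piFinset_univ, prodVec, star_prod,
    Finset.prod_mul_distrib]

theorem inner_tensorPow_prodVec_update {ι : Type*} [Fintype ι] {k : ℕ}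
    (ψ φ χ : EuclideanSpace ℂ ι) (j : Fin k) :
    inner ℂ (tensorPow k ψ) (prodVec (Function.update (fun _ => φ) j χ)) =
      inner ℂ ψ χ * inner ℂ ψ φ ^ (k - 1) := by
  have : tensorPow k ψ = prodVec fun _ => ψ := rfl
  rw [this, inner_prodVec, Fintype.prod_eq_mul_prod_compl j, Function.update_self]
  congr 1
  rw [Finset.prod_congr rfl (g := fun _ => inner ℂ ψ φ)]
  · simp [Finset.card_compl]
  · intro i hi
    rw [Function.update_of_ne (by simpa using hi)]

/-- The sum is the derivative of (φ + tχ)^{⊗k} at t = 0, so it is orthogonal to everything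
orthogonal to all tensor powers. -/
theorem sum_prodVec_update_mem {ι : Type*} [Fintype ι] {k : ℕ} (φ χ : EuclideanSpace ℂ ι) :
    ∑ j, prodVec (Function.update (fun _ : Fin k => φ) j χ) ∈ symSubspace ι k := by
  rw [← Submodule.orthogonal_orthogonal (symSubspace ι k), Submodule.mem_orthogonal]
  intro w hw
  have h0 : ∀ t : ℂ, inner ℂ w (tensorPow k (φ + t • χ)) = 0 := fun t =>
    (Submodule.mem_orthogonal' _ _).1 hw _ (tensorPow_mem_symSubspace k _)
  have hd : HasDerivAt (fun t : ℂ => inner ℂ w (tensorPow k (φ + t • χ)))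
      (∑ x, star (w x) * ∑ j, (∏ i ∈ Finset.univ.erase j, (φ (x i) + 0 * χ (x i))) • χ (x j)) 0 := by
    simp only [inner_eq_sum]
    change HasDerivAt (fun t => ∑ x, star (w x) * ∏ i, (φ (x i) + t * χ (x i))) _ 0
    refine HasDerivAt.fun_sum fun x _ => HasDerivAt.const_mul _ ?_
    refine HasDerivAt.fun_finsetProd (f := fun i t => φ (x i) + t * χ (x i)) fun i _ => ?_
    simpa using ((hasDerivAt_id (0 : ℂ)).mul_const (χ (x i))).const_add (φ (x i))
  simp only [h0] at hd
  rw [← (hasDerivAt_const (0 : ℂ) (0 : ℂ)).unique hd |>.symm, inner_eq_sum]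
  refine Finset.sum_congr rfl fun x _ => ?_
  congr 1
  simp only [WithLp.ofLp_sum, Finset.sum_apply]
  refine Finset.sum_congr rfl fun j _ => ?_
  simp only [prodVec]
  rw [← Finset.mul_prod_erase _ _ (Finset.mem_univ j), Function.update_self, smul_eq_mul, mul_comm]
  congr 1
  refine Finset.prod_congr rfl fun i hi => ?_
  rw [Function.update_of_ne (Finset.ne_of_mem_erase hi), zero_mul, add_zero]

/-- The inner product with ψ^{⊗k} does not depend on the slot holding χ, so averaging over slots
preserves it, and the average is symmetric. -/
theorem symProj_prodVec_update {ι : Type*} [Fintype ι] {k : ℕ} (φ χ : EuclideanSpace ℂ ι)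
    (j : Fin k) :
    symProj ι k (prodVec (Function.update (fun _ => φ) j χ)) =
      (k : ℂ)⁻¹ • ∑ i, prodVec (Function.update (fun _ => φ) i χ) := by
  have hk : (k : ℂ) ≠ 0 := by
    have := j.pos
    exact_mod_cast this.ne'
  refine Submodule.eq_starProjection_of_mem_of_inner_eq_zero
    (Submodule.smul_mem _ _ (sum_prodVec_update_mem φ χ)) fun w hw => ?_
  induction hw using Submodule.span_induction with
  | mem w hw =>
    obtain ⟨ψ, rfl⟩ := hw
    rw [← inner_conj_symm, inner_sub_right, inner_smul_right, inner_sum]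
    simp [inner_tensorPow_prodVec_update, hk]
  | zero => simp
  | add a b _ _ ha hb => rw [inner_add_right, ha, hb, add_zero]
  | smul c a _ ha => rw [inner_smul_right, ha, mul_zero]

theorem integrable_apply {N : ℕ} {ι : Type*} [Fintype ι] {f : SU N → EuclideanSpace ℂ ι}
    (hf : Continuous f) (x : ι) : Integrable (fun U => f U x) (haarSU N) :=
  integrable_haarSU ((PiLp.continuous_apply 2 _ x).comp hf)

theorem integrable_ketBra_rotPair {N : ℕ} [NeZero N] (p q : Fin N × Fin N) :
    Integrable (fun U => ketBra (rotPair N U) p q) (haarSU N) :=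
  integrable_haarSU ((continuous_ketBra p q).comp (continuous_rotPair N))

/-- Splitting off the first of `k` systems. -/
def extendFirstEquiv (ι : Type*) {k : ℕ} (hk : 0 < k) :
    ι × ({i : Fin k // i.val ≠ 0} → ι) ≃ (Fin k → ι) where
  toFun p := extendFirst p.1 p.2
  invFun x := (x ⟨0, hk⟩, fun i => x i)
  left_inv p := by
    ext i
    · simp [extendFirst]
    · simp [extendFirst, i.2]
  right_inv x := by
    ext i
    by_cases h : i.val = 0
    · have : i = ⟨0, hk⟩ := Fin.ext h
      subst this
      simp [extendFirst]
    · simp [extendFirst, h]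

theorem prod_extendFirst {ι M : Type*} [CommMonoid M] {k : ℕ} (hk : 0 < k) (a : ι)
    (z : {i : Fin k // i.val ≠ 0} → ι) (g : Fin k → ι → M) :
    ∏ i, g i (extendFirst a z i) = g ⟨0, hk⟩ a * ∏ i, g i.1 (z i) := by
  rw [Fintype.prod_eq_mul_prod_subtype_ne _ ⟨0, hk⟩]
  congr 1
  refine Fintype.prod_equiv (Equiv.subtypeEquivRight fun i => by simp [Fin.ext_iff]) _ _ fun i => ?_
  have : i.1.val ≠ 0 := fun h => i.2 (Fin.ext h)
  simp only [extendFirst, this, dif_neg, not_false_eq_true]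
  rfl

theorem sum_tensorPow_mul_star_symMaxEnt (N k : ℕ) [NeZero N] (hk : 0 < k) (U : SU N)
    (p q : Fin N × Fin N) :
    ∑ z, tensorPow k (rotPair N U) (extendFirst p z) * star (symMaxEnt N k (extendFirst q z)) =
      rotPair N U p * (1 / ((Real.sqrt (symDim (Fin N) k : ℝ) : ℝ) : ℂ)) *
        ((k : ℂ)⁻¹ * ((if q.1 = q.2 then 1 else 0) + ((k : ℂ) - 1) * star (rotPair N U q))) := by
  set φ := rotZero N U with hφ
  let f (c : Fin N) : EuclideanSpace ℂ (Fin k → Fin N) :=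
    prodVec (Function.update (fun _ => φ) ⟨0, hk⟩ (EuclideanSpace.single c 1))
  have hf : ∀ (c a : Fin N) (z : {i : Fin k // i.val ≠ 0} → Fin N),
      f c (extendFirst a z) = (if a = c then 1 else 0) * ∏ i, φ (z i) := by
    intro c a z
    simp only [f, prodVec]
    rw [prod_extendFirst hk a z
      (fun i a => Function.update (fun _ => φ) ⟨0, hk⟩ (EuclideanSpace.single c 1) i a)]
    congr 1
    · simp
    · refine Finset.prod_congr rfl fun i _ => ?_
      rw [Function.update_of_ne (fun h => i.2 (by rw [h]))]
  -- Of the k slot positions, the first gives the Kronecker delta; each of the other k - 1 gives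
  -- ⟨e_{q.1}, φ⟩⟨φ, e_{q.2}⟩.
  have hinner : inner ℂ (f q.1) (symProj (Fin N) k (f q.2)) =
      (k : ℂ)⁻¹ * ((if q.1 = q.2 then 1 else 0) + ((k : ℂ) - 1) * rotPair N U q) := by
    rw [symProj_prodVec_update, inner_smul_right, inner_sum,
      ← Finset.add_sum_erase _ _ (Finset.mem_univ (⟨0, hk⟩ : Fin k)),
      Finset.sum_congr rfl (g := fun _ => rotPair N U q)]
    · have h1 : ((k - 1 : ℕ) : ℂ) = (k : ℂ) - 1 := by push_cast [Nat.cast_sub hk]; rfl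
      congr 2
      · simp only [f]
        rw [inner_prodVec, Finset.prod_eq_single ⟨0, hk⟩]
        · simp [EuclideanSpace.inner_single_left]
        · intro i _ hi
          rw [Function.update_of_ne hi, Function.update_of_ne hi, inner_rotZero_self]
        · simp
      · simp [Finset.card_erase_of_mem, h1]
    · intro j hj
      have hj0 := Finset.ne_of_mem_erase hj
      simp only [f]
      rw [inner_prodVec, ← Finset.mul_prod_erase _ _ (Finset.mem_univ j),
        ← Finset.mul_prod_erase _ _ (Finset.mem_erase.2
          ⟨hj0.symm, Finset.mem_univ (⟨0, hk⟩ : Fin k)⟩),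
        Finset.prod_eq_one]
      · rw [Function.update_self, Function.update_self, Function.update_of_ne hj0,
          Function.update_of_ne hj0.symm]
        simp [EuclideanSpace.inner_single_left, EuclideanSpace.inner_single_right, rotPair,
          tensor, conjVec, hφ, mul_comm]
      · intro i hi
        simp only [Finset.mem_erase] at hi
        rw [Function.update_of_ne hi.1, Function.update_of_ne hi.2.1, inner_rotZero_self]
  have hfst : ∀ (p : Fin N × Fin N) (z : {i : Fin k // i.val ≠ 0} → Fin N × Fin N),
      (fun i => (extendFirst p z i).1) = extendFirst p.1 fun i => (z i).1 := by
    intro p z; ext i; by_cases h : i.val = 0 <;> simp [extendFirst, h]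
  have hsnd : ∀ (p : Fin N × Fin N) (z : {i : Fin k // i.val ≠ 0} → Fin N × Fin N),
      (fun i => (extendFirst p z i).2) = extendFirst p.2 fun i => (z i).2 := by
    intro p z; ext i; by_cases h : i.val = 0 <;> simp [extendFirst, h]
  -- The basis vectors in the first slot force the first pair to be q, which leaves the sum over the
  -- other pairs.
  have hsum := sum_mul_symMaxEnt N k (f q.1) (f q.2)
  rw [hinner, ← (extendFirstEquiv (Fin N × Fin N) hk).sum_comp, Fintype.sum_prod_type,
    Finset.sum_eq_single q] at hsum
  · have hs := congrArg star hsum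
    simp only [extendFirstEquiv, Equiv.coe_fn_mk, hfst, hsnd, hf, if_true, one_mul, star_sum,
      star_mul', star_star, star_prod] at hs
    have ht : ∀ z, tensorPow k (rotPair N U) (extendFirst p z) =
        rotPair N U p * ((∏ i, φ (z i).1) * ∏ i, star (φ (z i).2)) := by
      intro z
      rw [← Finset.prod_mul_distrib]
      exact prod_extendFirst hk p z fun _ => rotPair N U
    simp only [ht, mul_assoc (rotPair N U p)]
    rw [← Finset.mul_sum, hs]
    simp
  · intro p' _ hp
    refine Finset.sum_eq_zero fun z _ => ?_
    simp only [extendFirstEquiv, Equiv.coe_fn_mk, hfst, hsnd, hf]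
    by_cases h1 : p'.1 = q.1
    · have h2 : p'.2 ≠ q.2 := fun h2 => hp (Prod.ext h1 h2)
      simp [h2]
    · simp [h1]
  · simp

/-- This is the first Haar moment: for k = 1 the symmetric subspace is the whole space. -/
theorem integral_rotPair (N : ℕ) [NeZero N] (p : Fin N × Fin N) :
    ∫ U, rotPair N U p ∂(haarSU N) = if p.1 = p.2 then (N : ℂ)⁻¹ else 0 := by
  have htop : symSubspace (Fin N) 1 = ⊤ := by
    refine Submodule.eq_top_iff'.2 fun v => Submodule.subset_span
      ⟨WithLp.toLp 2 fun i => v fun _ => i, ?_⟩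
    ext x
    simp only [tensorPow, Finset.univ_unique, Finset.prod_singleton]
    refine congrArg v.ofLp (funext fun i => ?_)
    rw [Subsingleton.elim i default]
  have hdim : symDim (Fin N) 1 = N := by
    rw [symDim, htop]
    simp
  have h1 : Matrix.toEuclideanLin (haarMoment N 1) =
      Matrix.toEuclideanLin ((N : ℂ)⁻¹ • (1 : Matrix (Fin 1 → Fin N) (Fin 1 → Fin N) ℂ)) := by
    rw [toEuclideanLin_haarMoment, hdim, map_smul]
    congr 1
    refine LinearMap.ext fun v => ?_
    rw [symProj_of_mem (by rw [htop]; trivial)]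
    simp
  have h2 := congrFun₂ (Matrix.toEuclideanLin.injective h1) (fun _ => p.1) (fun _ => p.2)
  simp only [haarMoment, Matrix.of_apply, Matrix.smul_apply, Matrix.one_apply] at h2
  have h3 : ((fun _ : Fin 1 => p.1) = fun _ => p.2) ↔ p.1 = p.2 :=
    ⟨fun h => congrFun h 0, fun h => by rw [h]⟩
  simp only [h3] at h2
  simpa [ketBra, tensorPow, rotPair, tensor, conjVec] using h2

theorem ketBra_maxEnt (N : ℕ) [NeZero N] (p q : Fin N × Fin N) :
    ketBra (maxEnt N) p q =
      (if q.1 = q.2 then 1 else 0) * (if p.1 = p.2 then (N : ℂ)⁻¹ else 0) := by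
  have h : ∀ p, maxEnt N p = ((Real.sqrt (N : ℝ) : ℝ) : ℂ) * if p.1 = p.2 then (N : ℂ)⁻¹ else 0 := by
    intro p
    rw [maxEnt, PiLp.smul_apply, integral_apply (by fun_prop), integral_rotPair, smul_eq_mul]
  have hN : (N : ℂ) ≠ 0 := NeZero.ne _
  have hs : ((Real.sqrt (N : ℝ) : ℝ) : ℂ) * ((Real.sqrt (N : ℝ) : ℝ) : ℂ) = N := by
    rw [← Complex.ofReal_mul, Real.mul_self_sqrt (by positivity)]
    simp
  simp only [ketBra, Matrix.of_apply, h]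
  split_ifs <;> simp
  rw [mul_mul_mul_comm, hs]
  field_simp

/-- Only the ket is written as an integral; the bra is contracted under it. The factors √d and 1/√d
cancel. -/
theorem reduceFirst_symMaxEnt (N k : ℕ) [NeZero N] (hk : 0 < k) :
    reduceFirst (ketBra (symMaxEnt N k)) =
      rhoBar N + (k : ℂ)⁻¹ • (ketBra (maxEnt N) - rhoBar N) := by
  have hk0 : (k : ℂ) ≠ 0 := by exact_mod_cast hk.ne'
  have hd := sqrt_symDim_ne_zero N k
  ext p q
  have h1 : ∀ z, ketBra (symMaxEnt N k) (extendFirst p z) (extendFirst q z) =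
      ((Real.sqrt (symDim (Fin N) k) : ℝ) : ℂ) * ∫ U, tensorPow k (rotPair N U) (extendFirst p z) *
        star (symMaxEnt N k (extendFirst q z)) ∂(haarSU N) := by
    intro z
    rw [integral_mul_const, ← mul_assoc, ← integral_apply (by fun_prop)]
    rfl
  simp only [reduceFirst, Matrix.of_apply, h1]
  rw [← Finset.mul_sum, ← integral_finsetSum _ fun z _ =>
    (integrable_apply (f := fun U => tensorPow k (rotPair N U)) (by fun_prop)
      (extendFirst p z)).mul_const _]
  simp only [sum_tensorPow_mul_star_symMaxEnt N k hk]
  have h2 : ∀ U, rotPair N U p * (1 / ((Real.sqrt (symDim (Fin N) k : ℝ) : ℝ) : ℂ)) *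
        ((k : ℂ)⁻¹ * ((if q.1 = q.2 then 1 else 0) + ((k : ℂ) - 1) * star (rotPair N U q))) =
      (1 / ((Real.sqrt (symDim (Fin N) k : ℝ) : ℝ) : ℂ)) *
        ((k : ℂ)⁻¹ * (if q.1 = q.2 then 1 else 0) * rotPair N U p +
          (k : ℂ)⁻¹ * ((k : ℂ) - 1) * ketBra (rotPair N U) p q) := by
    intro U
    simp only [ketBra, Matrix.of_apply]
    ring
  simp only [h2]
  rw [integral_const_mul, integral_add ((integrable_apply (by fun_prop) _).const_mul _)
    ((integrable_ketBra_rotPair p q).const_mul _),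
    integral_const_mul, integral_const_mul, integral_rotPair]
  simp only [Matrix.add_apply, Matrix.smul_apply, Matrix.sub_apply, ketBra_maxEnt, rhoBar,
    Matrix.of_apply, smul_eq_mul]
  field_simp
  ring

/-! ### Compactness and separability -/

/-- By Carathéodory, dim E + 1 points suffice, so the hull is a continuous image of a simplex times
a power of s. -/
theorem _root_.IsCompact.convexHull_of_finiteDimensional {E : Type*} [AddCommGroup E] [Module ℝ E]
    [TopologicalSpace E] [IsTopologicalAddGroup E] [ContinuousSMul ℝ E] [FiniteDimensional ℝ E]
    {s : Set E} (hs : IsCompact s) : IsCompact (convexHull ℝ s) := by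
  rcases s.eq_empty_or_nonempty with rfl | ⟨x₀, hx₀⟩
  · simp
  let n := Module.finrank ℝ E + 1
  have hK : IsCompact (stdSimplex ℝ (Fin n) ×ˢ Set.univ.pi fun _ : Fin n => s) :=
    (isCompact_stdSimplex ℝ (Fin n)).prod (isCompact_univ_pi fun _ => hs)
  have hf : Continuous fun p : (Fin n → ℝ) × (Fin n → E) => ∑ i, p.1 i • p.2 i := by fun_prop
  convert hK.image hf using 1
  refine Set.Subset.antisymm (fun x hx => ?_) ?_
  · obtain ⟨ι, _, z, w, hz, hi, hw, hw1, rfl⟩ := eq_pos_convex_span_of_mem_convexHull hx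
    have hcard : Fintype.card ι ≤ Fintype.card (Fin n) := by
      simpa [n] using hi.card_le_finrank_succ.trans (Nat.succ_le_succ (Submodule.finrank_le _))
    obtain ⟨e⟩ := Function.Embedding.nonempty_of_card_le hcard
    have hz' : ∀ i, z i ∈ s := fun i => hz ⟨i, rfl⟩
    -- Shorter combinations are padded with weight 0 at the point x₀ of s.
    refine ⟨(Function.extend e w 0, Function.extend e z fun _ => x₀),
      ⟨⟨fun j => ?_, ?_⟩, fun j _ => ?_⟩, ?_⟩
    · by_cases hj : ∃ i, e i = j
      · obtain ⟨i, rfl⟩ := hj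
        simpa [e.injective.extend_apply] using (hw i).le
      · simp [Function.extend_apply' _ _ _ hj]
    · rw [← hw1]
      refine (Fintype.sum_of_injective e e.injective _ _ (fun j hj => ?_) fun i => ?_).symm
      · simp [Function.extend_apply' _ _ _ hj]
      · simp [e.injective.extend_apply]
    · by_cases hj : ∃ i, e i = j
      · obtain ⟨i, rfl⟩ := hj
        simpa [e.injective.extend_apply] using hz' i
      · simpa [Function.extend_apply' _ _ _ hj] using hx₀
    · refine (Fintype.sum_of_injective e e.injective _ _ (fun j hj => ?_) fun i => ?_).symm
      · simp [Function.extend_apply' _ _ _ hj]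
      · simp [e.injective.extend_apply]
  · rintro _ ⟨⟨w, z⟩, ⟨⟨hw0, hw1⟩, hz⟩, rfl⟩
    exact (convex_convexHull ℝ s).sum_mem (fun i _ => hw0 i) hw1
      fun i _ => subset_convexHull ℝ s (hz i trivial)

/-- The 2 × 2 minor on i, j gives |A i j|² ≤ A i i · A j j, and each diagonal entry is at most the
trace. -/
theorem IsDensity.norm_apply_le {ι : Type*} [Fintype ι] {A : Matrix ι ι ℂ} (hA : IsDensity A)
    (i j : ι) : ‖A i j‖ ≤ 1 := by
  have hre : ∀ i, 0 ≤ A i i := fun i => hA.1.diag_nonneg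
  have hle : ∀ i, A i i ≤ 1 := fun i => by
    rw [← hA.2]
    exact Finset.single_le_sum (f := fun i => A i i) (fun i _ => hre i) (Finset.mem_univ i)
  have hdet := (hA.1.submatrix ![i, j]).det_nonneg
  have hji : A j i = star (A i j) := (hA.1.1.apply j i).symm
  simp only [Matrix.det_fin_two, Matrix.submatrix_apply, Matrix.cons_val_zero,
    Matrix.cons_val_one, hji, Complex.star_def, Complex.mul_conj', sub_nonneg] at hdet
  have h1 : ((‖A i j‖ ^ 2 : ℝ) : ℂ) ≤ ((1 : ℝ) : ℂ) := by
    push_cast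
    exact hdet.trans (mul_le_one₀ (hle i) (hre j) (hle j))
  have h2 : ‖A i j‖ ^ 2 ≤ 1 := Complex.real_le_real.1 h1
  exact (sq_le_one_iff₀ (norm_nonneg _)).1 h2

theorem isCompact_setOf_isDensity (ι : Type*) [Fintype ι] :
    IsCompact {A : Matrix ι ι ℂ | IsDensity A} := by
  have hK : IsCompact
      (Set.univ.pi fun _ : ι => Set.univ.pi fun _ : ι => Metric.closedBall (0 : ℂ) 1) :=
    isCompact_univ_pi fun _ => isCompact_univ_pi fun _ => isCompact_closedBall _ _
  refine IsCompact.of_isClosed_subset hK ?_ fun A hA i _ j _ => by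
    simpa using hA.norm_apply_le i j
  have : {A : Matrix ι ι ℂ | IsDensity A} = {A | Aᴴ = A} ∩
      (⋂ x : ι → ℂ, {A | 0 ≤ star x ⬝ᵥ (A *ᵥ x)}) ∩ {A | A.trace = 1} := by
    ext A
    simp [IsDensity, Matrix.posSemidef_iff_dotProduct_mulVec, Matrix.IsHermitian]
  rw [this]
  refine ((isClosed_eq (by fun_prop) continuous_id).inter (isClosed_iInter fun x => ?_)).inter
    (isClosed_eq (by fun_prop) continuous_const)
  exact isClosed_le continuous_const (by fun_prop)

theorem isCompact_separableStates (ι κ : Type*) [Fintype ι] [Fintype κ] :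
    IsCompact (separableStates ι κ) := by
  refine IsCompact.convexHull_of_finiteDimensional ?_
  have hf : Continuous fun p : Matrix ι ι ℂ × Matrix κ κ ℂ => p.1 ⊗ₖ p.2 := by
    refine continuous_matrix fun i j => ?_
    simp only [Matrix.kroneckerMap_apply]
    fun_prop
  convert ((isCompact_setOf_isDensity ι).prod (isCompact_setOf_isDensity κ)).image hf using 1
  ext σ
  simp only [Set.mem_ofPred_eq, Set.mem_image, Set.mem_prod, Prod.exists]
  constructor
  · rintro ⟨A, B, hA, hB, rfl⟩; exact ⟨A, B, ⟨hA, hB⟩, rfl⟩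
  · rintro ⟨A, B, ⟨hA, hB⟩, rfl⟩; exact ⟨A, B, hA, hB, rfl⟩

theorem convex_setOf_isDensity (ι : Type*) [Fintype ι] :
    Convex ℝ {A : Matrix ι ι ℂ | IsDensity A} := by
  rintro A ⟨hA, hA1⟩ B ⟨hB, hB1⟩ a b ha hb hab
  refine ⟨(hA.smul ha).add (hB.smul hb), ?_⟩
  rw [Matrix.trace_add, Matrix.trace_smul, Matrix.trace_smul, hA1, hB1, ← add_smul, hab, one_smul]

theorem isDensity_of_mem_separableStates {ι κ : Type*} [Fintype ι] [Fintype κ]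
    {σ : Matrix (ι × κ) (ι × κ) ℂ} (hσ : σ ∈ separableStates ι κ) : IsDensity σ := by
  refine convexHull_min ?_ (convex_setOf_isDensity (ι × κ)) hσ
  rintro _ ⟨A, B, hA, hB, rfl⟩
  refine ⟨hA.1.kronecker hB.1, ?_⟩
  rw [Matrix.trace_kronecker, hA.2, hB.2, one_mul]

theorem ketBra_rotPair_mem (N : ℕ) [NeZero N] (U : SU N) :
    ∃ A B : Matrix (Fin N) (Fin N) ℂ, IsDensity A ∧ IsDensity B ∧
      ketBra (rotPair N U) = A ⊗ₖ B := by
  have h1 := inner_rotZero_self N U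
  refine ⟨ketBra (rotZero N U), ketBra (conjVec (rotZero N U)), isDensity_ketBra h1,
    isDensity_ketBra ?_, ?_⟩
  · rw [inner_eq_sum] at h1 ⊢
    rw [← h1]
    simp [conjVec, mul_comm]
  · ext p q
    simp [ketBra, rotPair, tensor, conjVec]
    ring

/-- The mean of a probability measure on a closed convex set stays in the set. -/
theorem rhoBar_mem_separableStates (N : ℕ) [NeZero N] :
    rhoBar N ∈ separableStates (Fin N) (Fin N) := by
  let f : SU N → Fin N × Fin N → Fin N × Fin N → ℂ := fun U => ketBra (rotPair N U)
  have hc : Continuous f := continuous_pi fun p => continuous_pi fun q =>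
    (continuous_ketBra p q).comp (continuous_rotPair N)
  have hi : Integrable f (haarSU N) := integrable_haarSU hc
  have h : rhoBar N = ∫ U, f U ∂(haarSU N) := by
    ext p q
    rw [eval_integral fun p => hi.eval p, eval_integral fun q => (hi.eval p).eval q]
    rfl
  let S : Set (Fin N × Fin N → Fin N × Fin N → ℂ) := separableStates (Fin N) (Fin N)
  have hS : Convex ℝ S := convex_convexHull ℝ _
  have hSc : IsClosed S := (isCompact_separableStates (Fin N) (Fin N)).isClosed
  have hmem : ∀ U, ketBra (rotPair N U) ∈ separableStates (Fin N) (Fin N) := fun U =>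
    subset_convexHull ℝ _ (ketBra_rotPair_mem N U)
  rw [h]
  exact hS.integral_mem hSc (Filter.Eventually.of_forall hmem) hi

/-! ### The trace norm -/

theorem trace_isHermitian_cfc {ι : Type*} [Fintype ι] [DecidableEq ι] {A : Matrix ι ι ℂ}
    (hA : A.IsHermitian) (f : ℝ → ℝ) : (hA.cfc f).trace.re = ∑ i, f (hA.eigenvalues i) := by
  rw [Matrix.IsHermitian.cfc, Unitary.conjStarAlgAut_apply, Matrix.trace_mul_cycle,
    Unitary.coe_star_mul_self, one_mul, Matrix.trace_diagonal]
  simp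

-- This form makes the continuity of the trace norm a consequence of the continuity of A ↦ |A|.
open scoped MatrixOrder in
theorem traceNorm_eq_trace_abs {ι : Type*} [Fintype ι] [DecidableEq ι] (A : Matrix ι ι ℂ) :
    traceNorm A = (CFC.abs A).trace.re := by
  have hH := Matrix.isHermitian_conjTranspose_mul_self A
  have h : CFC.abs A = hH.cfc Real.sqrt := by
    rw [CFC.abs, CFC.sqrt_eq_real_sqrt _ (star_mul_self_nonneg A), ← hH.cfc_eq, cfcₙ_eq_cfc]
    rfl
  rw [h, trace_isHermitian_cfc, traceNorm]

open scoped MatrixOrder in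
theorem traceNorm_eq_sum_abs_eigenvalues {ι : Type*} [Fintype ι] [DecidableEq ι]
    {A : Matrix ι ι ℂ} (hA : A.IsHermitian) : traceNorm A = ∑ i, |hA.eigenvalues i| := by
  rw [traceNorm_eq_trace_abs, CFC.abs_eq_cfc_norm A hA, hA.cfc_eq, trace_isHermitian_cfc]
  simp only [Real.norm_eq_abs]

open scoped MatrixOrder Matrix.Norms.L2Operator in
theorem continuous_traceNorm (ι : Type*) [Fintype ι] [DecidableEq ι] :
    Continuous (traceNorm : Matrix ι ι ℂ → ℝ) := by
  have h := CFC.continuous_abs (A := Matrix ι ι ℂ)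
  rw [funext traceNorm_eq_trace_abs]
  exact Complex.continuous_re.comp (Continuous.matrix_trace h)

/-- The trace norm of a difference of positive matrices is at most the sum of their traces. -/
theorem traceNorm_sub_le {ι : Type*} [Fintype ι] [DecidableEq ι] {X Y : Matrix ι ι ℂ}
    (hX : X.PosSemidef) (hY : Y.PosSemidef) :
    traceNorm (X - Y) ≤ X.trace.re + Y.trace.re := by
  have hA : (X - Y).IsHermitian := hX.1.sub hY.1
  -- In an eigenbasis of X - Y each eigenvalue is a difference x - y of nonnegative diagonal
  -- entries, and |x - y| ≤ x + y.
  let U : Matrix ι ι ℂ := hA.eigenvectorUnitary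
  have hU : U * Uᴴ = 1 := Unitary.coe_mul_star_self hA.eigenvectorUnitary
  have htr : ∀ Z : Matrix ι ι ℂ, Z.trace.re = ∑ i, ((Uᴴ * Z * U) i i).re := by
    intro Z
    have : (Uᴴ * Z * U).trace = Z.trace := by
      rw [Matrix.trace_mul_cycle, hU, one_mul]
    rw [← this, Matrix.trace, Complex.re_sum]
    rfl
  have hnn : ∀ {Z : Matrix ι ι ℂ}, Z.PosSemidef → ∀ i, 0 ≤ ((Uᴴ * Z * U) i i).re := by
    intro Z hZ i
    exact (Complex.nonneg_iff.1 (hZ.conjTranspose_mul_mul_same U).diag_nonneg).1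
  have heig : ∀ i, hA.eigenvalues i = ((Uᴴ * X * U) i i).re - ((Uᴴ * Y * U) i i).re := by
    intro i
    have h := hA.conjStarAlgAut_star_eigenvectorUnitary
    rw [Unitary.conjStarAlgAut_apply] at h
    have h' : Uᴴ * X * U - Uᴴ * Y * U = Matrix.diagonal (RCLike.ofReal ∘ hA.eigenvalues) := by
      rw [← h, ← Matrix.sub_mul, ← Matrix.mul_sub]
      simp [U, Matrix.star_eq_conjTranspose]
    rw [← Complex.sub_re, ← Matrix.sub_apply, h']
    simp
  rw [traceNorm_eq_sum_abs_eigenvalues hA, htr X, htr Y, ← Finset.sum_add_distrib]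
  refine Finset.sum_le_sum fun i _ => ?_
  rw [heig, abs_le]
  constructor <;> linarith [hnn hX i, hnn hY i]

/-! ### Distance to the separable states and the polynomial bound -/

theorem exists_isMinDistSep {ι κ : Type*} [Fintype ι] [Fintype κ] [DecidableEq ι] [DecidableEq κ]
    (ρ : Matrix (ι × κ) (ι × κ) ℂ) (h : (separableStates ι κ).Nonempty) :
    ∃ r, IsMinDistSep ρ r := by
  obtain ⟨σ, hσ, hmin⟩ := (isCompact_separableStates ι κ).exists_isMinOn h
    (f := fun σ => traceNorm (ρ - σ))
    ((continuous_traceNorm (ι × κ)).comp (continuous_const.sub continuous_id)).continuousOn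
  refine ⟨_, ⟨σ, hσ, rfl⟩, ?_⟩
  rintro _ ⟨τ, hτ, rfl⟩
  exact hmin hτ

theorem traceNorm_sub_smul_le {ι : Type*} [Fintype ι] [DecidableEq ι] {X Y : Matrix ι ι ℂ}
    (hX : IsDensity X) (hY : IsDensity Y) {t : ℝ} (ht : 0 ≤ t) :
    traceNorm ((t : ℂ) • (X - Y)) ≤ 2 * t := by
  have ht' : (0 : ℂ) ≤ (t : ℂ) := by exact_mod_cast ht
  have h := traceNorm_sub_le (hX.1.smul ht') (hY.1.smul ht')
  rw [← smul_sub, Matrix.trace_smul, Matrix.trace_smul, hX.2, hY.2, smul_eq_mul, mul_one,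
    Complex.ofReal_re] at h
  linarith

theorem inner_maxEnt_self (N : ℕ) [NeZero N] : inner ℂ (maxEnt N) (maxEnt N) = 1 := by
  have hN : (N : ℂ) ≠ 0 := NeZero.ne _
  have h : ∀ p, star (maxEnt N p) * maxEnt N p = ketBra (maxEnt N) p p := fun p => mul_comm _ _
  rw [inner_eq_sum]
  simp only [h, ketBra_maxEnt, Fintype.sum_prod_type]
  simp [hN]

theorem twoSite_eq (n m : ℕ) (hm : 0 < m) (he : Even m) :
    twoSite n m = rhoBar (2 ^ n) +
      (2 / (m : ℂ)) • (ketBra (maxEnt (2 ^ n)) - rhoBar (2 ^ n)) := by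
  obtain ⟨k, rfl⟩ := he
  have hk : (k + k) / 2 = k := by omega
  have hk0 : (k : ℂ) ≠ 0 := by
    have : k ≠ 0 := by omega
    exact_mod_cast this
  rw [twoSite, hk, reduceFirst_symMaxEnt _ _ (by omega)]
  congr 2
  push_cast
  field_simp
  norm_num

/-- The state ρ̄ is the competitor: its difference from the reduced state is 2/m times a difference
of two density matrices. -/
theorem exists_isMinDistSep_twoSite_le (n m : ℕ) (hm : 0 < m) (he : Even m) :
    ∃ r : ℝ, IsMinDistSep (twoSite n m) r ∧ r ≤ 4 / (m : ℝ) := by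
  obtain ⟨r, hr⟩ := exists_isMinDistSep (twoSite n m) ⟨_, rhoBar_mem_separableStates (2 ^ n)⟩
  refine ⟨r, hr, (hr.2 ⟨_, rhoBar_mem_separableStates (2 ^ n), rfl⟩).trans ?_⟩
  have h := traceNorm_sub_smul_le (isDensity_ketBra (inner_maxEnt_self (2 ^ n)))
    (isDensity_of_mem_separableStates (rhoBar_mem_separableStates (2 ^ n)))
    (t := 2 / (m : ℝ)) (by positivity)
  push_cast at h
  beta_reduce
  rw [twoSite_eq n m hm he, add_sub_cancel_left]
  exact h.trans_eq (by ring)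

/-- Round each coefficient up to a natural number; the powers of n are nonnegative. -/
theorem exists_polynomial_nat_ge (q : Polynomial ℝ) :
    ∃ P : Polynomial ℕ, ∀ n : ℕ, q.eval (n : ℝ) ≤ P.eval n := by
  induction q using Polynomial.induction_on' with
  | add p q hp hq =>
    obtain ⟨P, hP⟩ := hp
    obtain ⟨Q, hQ⟩ := hq
    refine ⟨P + Q, fun n => ?_⟩
    rw [Polynomial.eval_add, Polynomial.eval_add, Nat.cast_add]
    exact add_le_add (hP n) (hQ n)
  | monomial k a =>
    refine ⟨Polynomial.monomial k ⌈a⌉₊, fun n => ?_⟩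
    rw [Polynomial.eval_monomial, Polynomial.eval_monomial, Nat.cast_mul, Nat.cast_pow]
    exact mul_le_mul_of_nonneg_right (Nat.le_ceil a) (by positivity)

end SymEnt

end

theorem mainTheorem3 :
    (∀ n m : ℕ, 0 < m → Even m →
      -- the state lies in the class considered in the conjecture
      SymEnt.IsStateOn (SymEnt.symOddEven (Fin (2 ^ n)) (m / 2))
        (SymEnt.ketBra (SymEnt.symMaxEnt (2 ^ n) (m / 2))) ∧
      SymEnt.IsStateOn (SymEnt.symSubspace (Fin (2 ^ n) × Fin (2 ^ n)) (m / 2))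
        (SymEnt.ketBra (SymEnt.symMaxEnt (2 ^ n) (m / 2))) ∧
      -- it is maximally entangled across the odd / even partition
      Matrix.toEuclideanLin (SymEnt.partialTranspose (SymEnt.symMaxEnt (2 ^ n) (m / 2))) =
        (1 / ((Real.sqrt (SymEnt.symDim (Fin (2 ^ n)) (m / 2) : ℝ) : ℝ) : ℂ)) •
          SymEnt.symProj (Fin (2 ^ n)) (m / 2) ∧
      -- its two-site reduced state
      SymEnt.twoSite n m =
        SymEnt.rhoBar (2 ^ n) +
          (2 / (m : ℂ)) • (SymEnt.ketBra (SymEnt.maxEnt (2 ^ n)) - SymEnt.rhoBar (2 ^ n)) ∧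
      SymEnt.rhoBar (2 ^ n) ∈ SymEnt.separableStates (Fin (2 ^ n)) (Fin (2 ^ n)) ∧
      ∃ r : ℝ, SymEnt.IsMinDistSep (SymEnt.twoSite n m) r ∧ r ≤ 4 / (m : ℝ)) ∧
    (∀ q : Polynomial ℝ, (∀ n : ℕ, 0 < q.eval (n : ℝ)) →
      ∃ p : Polynomial ℕ, ∀ n : ℕ, 0 < p.eval n ∧ Even (p.eval n) ∧
        ∃ r : ℝ, SymEnt.IsMinDistSep (SymEnt.twoSite n (p.eval n)) r ∧
          r < 1 / q.eval (n : ℝ)) := by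
  refine ⟨fun n m hm he => ⟨?_, ?_, ?_, ?_, ?_, ?_⟩, fun q hq => ?_⟩
  · exact SymEnt.isStateOn_ketBra (SymEnt.inner_symMaxEnt_self _ _)
      (SymEnt.symMaxEnt_mem_symOddEven _ _)
  · exact SymEnt.isStateOn_ketBra (SymEnt.inner_symMaxEnt_self _ _)
      (SymEnt.symMaxEnt_mem_symSubspace _ _)
  · exact SymEnt.toEuclideanLin_partialTranspose_symMaxEnt _ _
  · exact SymEnt.twoSite_eq n m hm he
  · exact SymEnt.rhoBar_mem_separableStates _
  · exact SymEnt.exists_isMinDistSep_twoSite_le n m hm he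
  · obtain ⟨P, hP⟩ := SymEnt.exists_polynomial_nat_ge q
    have hev : ∀ n, (4 * P + 2).eval n = 4 * P.eval n + 2 := fun n => by simp
    -- The summand 2 keeps m even, makes it positive even where P vanishes, and makes the bound
    -- strict: 4q ≤ 4P < m.
    refine ⟨4 * P + 2, fun n => ?_⟩
    have he : Even ((4 * P + 2).eval n) := ⟨2 * P.eval n + 1, by rw [hev]; ring⟩
    have hpos : 0 < (4 * P + 2).eval n := by rw [hev]; omega
    obtain ⟨r, hr, hle⟩ := SymEnt.exists_isMinDistSep_twoSite_le n _ hpos he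
    refine ⟨hpos, he, r, hr, hle.trans_lt ?_⟩
    rw [div_lt_div_iff₀ (by exact_mod_cast hpos) (hq n), hev]
    push_cast
    linarith [hP n]
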